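/- Let $\mathcal N=\{1,\dots,n\}$ be a set of products, $\mathcal S$ a collection of assortments (subsets of $\mathcal N$), and $\mathcal I_{\mathcal S}=\{(i,S): S\in\mathcal S,\ i\in S\}$. Let $\boldsymbol p=(p_{i,S})_{(i,S)\in\mathcal I_{\mathcal S}}$ be choice data, i.e. $p_{i,S}\ge 0$ and $\sum_{i\in S}p_{i,S}=1$ for every $S\in\mathcal S$. A marginal distribution model (MDM) consists of deterministic utilities $\nu_1,\dots,\nu_n\in\mathbb R$ and of laws $F_1,\dots,F_n$ on $\mathbb R$ that are absolutely continuous, have finite mean, and have distribution functions that are strictly increasing on their supports. For an assortment $S$, let $\theta^*_S$ attain the maximum of $\mathbb E_\theta[\max_{i\in S}(\nu_i+\tilde\epsilon_i)]$ over all joint laws $\theta$ of $(\tilde\epsilon_1,\dots,\tilde\epsilon_n)$ with marginals $F_1,\dots,F_n$; the choice probabilities of the MDM are $\mathbb P_{\theta^*_S}(i=\arg\max_{j\in S}(\nu_j+\tilde\epsilon_j))$, $i\in S$. Let $\mathcal P_{\mathrm{mdm}}(\mathcal S)\subseteq\mathbb R^{\mathcal I_{\mathcal S}}$ be the set of vectors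 $(x_{i,S})$ that are the choice probabilities of some MDM (the same MDM for all $S\in\mathcal S$). For each $S\in\mathcal S$ let $x_S\mapsto\mathrm{loss}_S(p_S,x_S)\in[0,\infty]$ be convex and continuous on the probability simplex over $S$. The limit of MDM is $$\mathcal L(\boldsymbol p)=\inf\Big\{\sum_{S\in\mathcal S}\mathrm{loss}_S(p_S,x_S)\;:\;\boldsymbol x\in\mathcal P_{\mathrm{mdm}}(\mathcal S)\Big\}.$$ Suppose that $\mathcal S$ is nested ($\mathcal S=\{S_1,\dots,S_m\}$ with $S_1\subset S_2\subset\dots\subset S_m$) or laminar (any two distinct members are disjoint or related by containment). Then $\mathcal L(\boldsymbol p)$ equals the value of the convex program $$\min_{\boldsymbol x}\ \sum_{S\in\mathcal S}\mathrm{loss}_S(p_S,x_S)\quad\text{s.t.}\quad x_{i,S}\ge x_{i,T}\ \text{ if } S\subset T,\ (i,S),(i,T)\in\mathcal I_{\mathcal S};\quad \sum_{i\in S}x_{i,S}=1,\ S\in\mathcal S;\quad x_{i,S}\ge 0,\ (i,S)\in\mathcal I_{\mathcal S},$$ and the minimum is attained. The program has at most $n|\mathcal S|$ (so $O(n|\mathcal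 S|)$) continuous variables and at most $2n|\mathcal S|^2$ (so $O(n|\mathcal S|^2)$) linear constraints, whose coefficients and right-hand sides lie in $\{-1,0,1\}$. Moreover $\mathcal L(\boldsymbol p)$ is also the attained minimum of the same objective over all pairs $(\boldsymbol x,\boldsymbol\lambda)$, $\boldsymbol\lambda\in\mathbb R^{\mathcal S}$, that satisfy the last two groups of constraints and $x_{i,S}\ge x_{i,T}$ whenever $\lambda_S\le\lambda_T$, $(i,S),(i,T)\in\mathcal I_{\mathcal S}$. -/

import Mathlib

open MeasureTheory ProbabilityTheory
open scoped NNReal ENNReal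

noncomputable section

/-! ### Assortment collections and choice probability vectors -/

/-- The product-assortment pairs `(S, i)` with `S ∈ 𝒮` and `i ∈ S`. -/
abbrev PairIdx {n : ℕ} (𝒮 : Finset (Finset (Fin n))) : Type :=
  Σ S : {S : Finset (Fin n) // S ∈ 𝒮}, {i : Fin n // i ∈ S.1}

/-- The block `x_S = (x_{i,S} : i ∈ S)` of a vector `x` indexed by product-assortment pairs. -/
def block {n : ℕ} {𝒮 : Finset (Finset (Fin n))} (x : PairIdx 𝒮 → ℝ)
    (S : {S : Finset (Fin n) // S ∈ 𝒮}) : {i : Fin n // i ∈ S.1} → ℝ :=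
  fun i => x ⟨S, i⟩

/-- `p` is a collection of choice probabilities: for every assortment `S ∈ 𝒮`, the block `p_S` is
non-negative and sums to one. -/
def IsChoiceData {n : ℕ} {𝒮 : Finset (Finset (Fin n))} (p : PairIdx 𝒮 → ℝ) : Prop :=
  ∀ S : {S : Finset (Fin n) // S ∈ 𝒮}, block p S ∈ stdSimplex ℝ {i : Fin n // i ∈ S.1}

/-- Nested: the assortments can be indexed as `S_1 ⊂ S_2 ⊂ … ⊂ S_m`. -/
def IsNested {n : ℕ} (𝒮 : Finset (Finset (Fin n))) : Prop :=
  ∃ (m : ℕ) (s : Fin m → Finset (Fin n)), StrictMono s ∧ ∀ S, S ∈ 𝒮 ↔ ∃ k, s k = S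

/-- Laminar: any two distinct assortments are related by containment or disjoint. -/
def IsLaminar {n : ℕ} (𝒮 : Finset (Finset (Fin n))) : Prop :=
  ∀ S ∈ 𝒮, ∀ T ∈ 𝒮, S ≠ T → S ⊂ T ∨ T ⊂ S ∨ S ∩ T = ∅

/-! ### The marginal distribution model -/

/-- The data of a marginal distribution model on `n` products: deterministic utilities `ν_i`, and
the laws of the random terms `ε_i`, each of which is an absolutely continuous probability
distribution with finite mean whose distribution function is strictly increasing on its support. -/
structure MDMData (n : ℕ) where
  ν : Fin n → ℝ
  law : Fin n → Measure ℝ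
  isProbabilityMeasure_law : ∀ i, IsProbabilityMeasure (law i)
  absolutelyContinuous_law : ∀ i, law i ≪ volume
  strictMonoOn_cdf : ∀ i, StrictMonoOn (fun t => cdf (law i) t) (law i).support
  integrable_law : ∀ i, Integrable (fun t : ℝ => t) (law i)

/-- The joint distributions `θ` of `(ε_1, …, ε_n)` with the prescribed marginals. -/
def MDMData.jointLaws {n : ℕ} (M : MDMData n) : Set (Measure (Fin n → ℝ)) :=
  {θ | IsProbabilityMeasure θ ∧ ∀ i, θ.map (fun ε => ε i) = M.law i}

/-- The expected maximal utility `E_θ [max_{i ∈ S} (ν_i + ε_i)]` (for nonempty `S`). -/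
def MDMData.expectedMax {n : ℕ} (M : MDMData n) (S : Finset (Fin n))
    (θ : Measure (Fin n → ℝ)) : ℝ :=
  ∫ ε, ⨆ i : {i : Fin n // i ∈ S}, (M.ν i.1 + ε i.1) ∂θ

/-- `θ` attains the maximum of the expected maximal utility over `S` among all joint
distributions with the prescribed marginals. -/
def MDMData.IsExtremal {n : ℕ} (M : MDMData n) (S : Finset (Fin n))
    (θ : Measure (Fin n → ℝ)) : Prop :=
  θ ∈ M.jointLaws ∧ ∀ θ' ∈ M.jointLaws, M.expectedMax S θ' ≤ M.expectedMax S θ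

/-- The probability under `θ` that product `i` is the utility maximizer in `S`. -/
def MDMData.choiceProb {n : ℕ} (M : MDMData n) (S : Finset (Fin n))
    (θ : Measure (Fin n → ℝ)) (i : Fin n) : ℝ :=
  θ.real {ε | ∀ j ∈ S, j ≠ i → M.ν j + ε j < M.ν i + ε i}

/-- The choice probability vectors over `𝒮` that are representable by some MDM. The utilities and
the marginals are common to all assortments; the extremal joint distribution depends on the
assortment. -/
def mdmRepresentable {n : ℕ} (𝒮 : Finset (Finset (Fin n))) : Set (PairIdx 𝒮 → ℝ) :=
  {x | ∃ M : MDMData n, ∀ S : {S : Finset (Fin n) // S ∈ 𝒮}, ∃ θ : Measure (Fin n → ℝ),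
    M.IsExtremal S.1 θ ∧ ∀ i, block x S i = M.choiceProb S.1 θ i.1}

/-! ### Losses and the limit of MDM -/

/-- Losses on single assortments: `loss S p_S x_S ∈ [0, ∞]`. -/
abbrev LossFamily (n : ℕ) : Type :=
  ∀ S : Finset (Fin n), ({i : Fin n // i ∈ S} → ℝ) → ({i : Fin n // i ∈ S} → ℝ) → ℝ≥0∞

/-- The total loss `∑_{S ∈ 𝒮} loss(p_S, x_S)`. -/
def totalLoss {n : ℕ} {𝒮 : Finset (Finset (Fin n))} (loss : LossFamily n)
    (p x : PairIdx 𝒮 → ℝ) : ℝ≥0∞ :=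
  ∑ S : {S : Finset (Fin n) // S ∈ 𝒮}, loss S.1 (block p S) (block x S)

/-- The limit of MDM: the infimum of the loss over all MDM-representable vectors. -/
def mdmLimit {n : ℕ} {𝒮 : Finset (Finset (Fin n))} (loss : LossFamily n)
    (p : PairIdx 𝒮 → ℝ) : ℝ≥0∞ :=
  ⨅ x ∈ mdmRepresentable 𝒮, totalLoss loss p x

/-- The feasible pairs `(x, lam)` of the general program for the limit: `x_{i,S} ≥ x_{i,T}` whenever
`lam_S ≤ lam_T`, together with the simplex constraints. -/
def rankingFeasible {n : ℕ} (𝒮 : Finset (Finset (Fin n))) :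
    Set ((PairIdx 𝒮 → ℝ) × ({S : Finset (Fin n) // S ∈ 𝒮} → ℝ)) :=
  {q | (∀ a b : PairIdx 𝒮, a.2.1 = b.2.1 → q.2 a.1 ≤ q.2 b.1 → q.1 b ≤ q.1 a) ∧
    (∀ S : {S : Finset (Fin n) // S ∈ 𝒮}, ∑ i : {i : Fin n // i ∈ S.1}, q.1 ⟨S, i⟩ = 1) ∧
    (∀ a : PairIdx 𝒮, 0 ≤ q.1 a)}

/-! ### Linearly constrained programs -/

/-- A linear constraint `∑ a_j x_j ≥ b` or `∑ a_j x_j = b` on real variables `(x_j)_{j ∈ ι}`. -/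
inductive LinConstraint (ι : Type) : Type
  | ge (a : ι → ℝ) (b : ℝ) : LinConstraint ι
  | eq (a : ι → ℝ) (b : ℝ) : LinConstraint ι

namespace LinConstraint

/-- The coefficients of a linear constraint. -/
def coeff {ι : Type} : LinConstraint ι → ι → ℝ
  | ge a _ => a
  | eq a _ => a

/-- The right-hand side of a linear constraint. -/
def rhs {ι : Type} : LinConstraint ι → ℝ
  | ge _ b => b
  | eq _ b => b

/-- `x` satisfies the constraint. -/
def Holds {ι : Type} [Fintype ι] : LinConstraint ι → (ι → ℝ) → Prop
  | ge a b, x => b ≤ ∑ j, a j * x j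
  | eq a b, x => ∑ j, a j * x j = b

end LinConstraint

/-- A minimization program in the real variables `(x_j)_{j ∈ ι}` with a finite list of linear
constraints and an objective with values in `[0, ∞]`. -/
structure LinConstrainedProgram (ι : Type) [Fintype ι] where
  objective : (ι → ℝ) → ℝ≥0∞
  numConstraints : ℕ
  constraint : Fin numConstraints → LinConstraint ι

/-- The feasible region. -/
def LinConstrainedProgram.feasible {ι : Type} [Fintype ι] (P : LinConstrainedProgram ι) :
    Set (ι → ℝ) :=
  {x | ∀ k, (P.constraint k).Holds x}

/-- The program is convex: the feasible region is convex and the objective is convex on it. -/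
def LinConstrainedProgram.IsConvex {ι : Type} [Fintype ι] (P : LinConstrainedProgram ι) : Prop :=
  Convex ℝ P.feasible ∧ ConvexOn ℝ≥0 P.feasible P.objective

/-- `v` is the optimal value of the program, and it is attained. -/
def LinConstrainedProgram.HasMin {ι : Type} [Fintype ι] (P : LinConstrainedProgram ι)
    (v : ℝ≥0∞) : Prop :=
  IsLeast (P.objective '' P.feasible) v

/-! ### The regularity program -/

/-- The pairs `((i,S), (i,T))` of product-assortment pairs with a common product and `S ⊂ T`. -/
abbrev RegularityIdx {n : ℕ} (𝒮 : Finset (Finset (Fin n))) : Type :=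
  {t : PairIdx 𝒮 × PairIdx 𝒮 // t.1.2.1 = t.2.2.1 ∧ t.1.1.1 ⊂ t.2.1.1}

/-- One index for each regularity, each normalization and each non-negativity constraint. -/
abbrev RegularityConstraintIdx {n : ℕ} (𝒮 : Finset (Finset (Fin n))) : Type :=
  RegularityIdx 𝒮 ⊕ ({S : Finset (Fin n) // S ∈ 𝒮} ⊕ PairIdx 𝒮)

/-- The constraints `x_{i,S} - x_{i,T} ≥ 0` for `S ⊂ T`, `∑_{i ∈ S} x_{i,S} = 1`, and
`x_{i,S} ≥ 0`. -/
def regularityConstraint {n : ℕ} (𝒮 : Finset (Finset (Fin n))) :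
    RegularityConstraintIdx 𝒮 → LinConstraint (PairIdx 𝒮)
  | .inl t => .ge (Pi.single t.1.1 1 - Pi.single t.1.2 1) 0
  | .inr (.inl S) => .eq (fun a => if a.1 = S then 1 else 0) 1
  | .inr (.inr a) => .ge (Pi.single a 1) 0

/-- Minimize `∑_{S ∈ 𝒮} loss(p_S, x_S)` subject to the regularity and the simplex constraints. -/
def regularityProgram {n : ℕ} {𝒮 : Finset (Finset (Fin n))} (loss : LossFamily n)
    (p : PairIdx 𝒮 → ℝ) : LinConstrainedProgram (PairIdx 𝒮) where
  objective := totalLoss loss p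
  numConstraints := Fintype.card (RegularityConstraintIdx 𝒮)
  constraint := fun k =>
    regularityConstraint 𝒮 ((Fintype.equivFin (RegularityConstraintIdx 𝒮)).symm k)

end

/-!
For every level `l` and every joint law,
`E max_{i ∈ S} (ν_i + ε_i) ≤ l + ∑_{i ∈ S} E (ν_i + ε_i - l)⁺`, and the right-hand side depends on
the marginals alone. Equality means that almost surely exactly one product of `S` has utility above
`l`, and a coupling with this property exists precisely when the probabilities `P (ν_i + ε_i > l)`
sum to one over `S`; these probabilities are then the choice probabilities of every extremal law.
By continuity there is such a level as soon as `|S| ≥ 2`. If `S ⊂ T`, either the level of `S` is the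
smaller one, or the probabilities for `T` dominate those for `S` on `S` and hence coincide with
them, as both sum to one. In both cases `x_{i,S} ≥ x_{i,T}`.

Conversely, on a laminar collection the assortments containing a product `i` form a chain on which
`x_{i,S}` is antitone in `|S|`. Mixing with the uniform choice probabilities makes it strictly
antitone, hence the restriction to the integers `|S|` of the survival function of an admissible
marginal. So the closure of the representable vectors is the polytope of regular vectors, and the
loss, being continuous on this compact set, attains there its infimum over the representable ones.
-/

/-! ### The expected maximum of finitely many random variables -/

section ExpectedMax

variable {ι : Type*}

section Pointwise

variable [Fintype ι] [Nonempty ι]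

lemma ciSup_le_add_sum_max (z : ι → ℝ) (l : ℝ) : ⨆ i, z i ≤ l + ∑ i, max (z i - l) 0 :=
  ciSup_le fun i => sub_le_iff_le_add'.1 <| (le_max_left _ _).trans <|
    Finset.single_le_sum (f := fun j => max (z j - l) 0) (fun _ _ => le_max_right _ _)
      (Finset.mem_univ i)

lemma ciSup_eq_add_sum_max_iff (z : ι → ℝ) (l : ℝ) :
    ⨆ i, z i = l + ∑ i, max (z i - l) 0 ↔ ∃ k, l ≤ z k ∧ ∀ j ≠ k, z j ≤ l := by
  classical
  constructor
  · intro h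
    obtain ⟨k, hk⟩ := exists_eq_ciSup_of_finite (f := z)
    have hsum : z k - l = ∑ i, max (z i - l) 0 := by linarith
    have hlk : 0 ≤ z k - l := hsum ▸ Finset.sum_nonneg fun _ _ => le_max_right _ _
    have hrest : ∑ i ∈ Finset.univ.erase k, max (z i - l) 0 = 0 := by
      rw [← Finset.add_sum_erase _ _ (Finset.mem_univ k), max_eq_left hlk] at hsum
      linarith
    refine ⟨k, sub_nonneg.1 hlk, fun j hj => sub_nonpos.1 <| max_eq_right_iff.1 ?_⟩
    exact (Finset.sum_eq_zero_iff_of_nonneg fun _ _ => le_max_right _ _).1 hrest j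
      (Finset.mem_erase.2 ⟨hj, Finset.mem_univ j⟩)
  · rintro ⟨k, hk, hrest⟩
    have hsum : ∑ i, max (z i - l) 0 = z k - l := by
      rw [Finset.sum_eq_single k (fun j _ hj => max_eq_right (sub_nonpos.2 (hrest j hj)))
        (fun h => absurd (Finset.mem_univ k) h), max_eq_left (sub_nonneg.2 hk)]
    refine le_antisymm (ciSup_le_add_sum_max z l) ?_
    rw [hsum, add_sub_cancel]
    exact le_ciSup (Set.finite_range z).bddAbove k

end Pointwise

lemma forall_ne_lt_iff_lt_of_forall_ne_lt {α : Type*} [Preorder α] {z : ι → α} {l : α} {k : ι}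
    (hk : l < z k) (hrest : ∀ j ≠ k, z j < l) (i : ι) : (∀ j ≠ i, z j < z i) ↔ l < z i := by
  by_cases hik : i = k
  · subst hik
    exact iff_of_true (fun j hj => (hrest j hj).trans hk) hk
  · exact iff_of_false (fun h => (h k (Ne.symm hik)).not_gt ((hrest i hik).trans hk))
      (hrest i hik).not_gt

variable {Ω : Type*} [MeasurableSpace Ω] {μ : Measure Ω} {Z : ι → Ω → ℝ}

lemma integrable_ciSup [Finite ι] [Nonempty ι] (hZ : ∀ i, Integrable (Z i) μ) :
    Integrable (fun ω => ⨆ i, Z i ω) μ := by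
  have := Fintype.ofFinite ι
  refine (integrable_finsetSum Finset.univ fun i _ => (hZ i).norm).mono'
    (AEMeasurable.iSup fun i => (hZ i).aemeasurable).aestronglyMeasurable (.of_forall fun ω => ?_)
  obtain ⟨k, hk⟩ := exists_eq_ciSup_of_finite (f := fun i => Z i ω)
  rw [← hk]
  exact Finset.single_le_sum (f := fun i => ‖Z i ω‖) (fun _ _ => norm_nonneg _) (Finset.mem_univ k)

lemma integrable_max_sub_zero [IsFiniteMeasure μ] {f : Ω → ℝ} (hf : Integrable f μ) (l : ℝ) :
    Integrable (fun ω => max (f ω - l) 0) μ :=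
  (hf.sub (integrable_const l)).pos_part

variable [Fintype ι] [IsProbabilityMeasure μ]

lemma integrable_add_sum_max (hZ : ∀ i, Integrable (Z i) μ) (l : ℝ) :
    Integrable (fun ω => l + ∑ i, max (Z i ω - l) 0) μ :=
  (integrable_const l).add (integrable_finsetSum _ fun i _ => integrable_max_sub_zero (hZ i) l)

lemma integral_add_sum_max (hZ : ∀ i, Integrable (Z i) μ) (l : ℝ) :
    ∫ ω, (l + ∑ i, max (Z i ω - l) 0) ∂μ = l + ∑ i, ∫ ω, max (Z i ω - l) 0 ∂μ := by
  have hint := fun i => integrable_max_sub_zero (hZ i) l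
  rw [integral_add (integrable_const l) (integrable_finsetSum _ fun i _ => hint i),
    integral_finsetSum _ fun i _ => hint i]
  simp

variable [Nonempty ι]

lemma integral_ciSup_le_add_sum_integral_max (hZ : ∀ i, Integrable (Z i) μ) (l : ℝ) :
    ∫ ω, ⨆ i, Z i ω ∂μ ≤ l + ∑ i, ∫ ω, max (Z i ω - l) 0 ∂μ := by
  rw [← integral_add_sum_max hZ]
  exact integral_mono (integrable_ciSup hZ) (integrable_add_sum_max hZ l)
    fun ω => ciSup_le_add_sum_max (fun i => Z i ω) l

lemma integral_ciSup_eq_add_sum_integral_max_iff (hZ : ∀ i, Integrable (Z i) μ) (l : ℝ) :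
    ∫ ω, ⨆ i, Z i ω ∂μ = l + ∑ i, ∫ ω, max (Z i ω - l) 0 ∂μ ↔
      ∀ᵐ ω ∂μ, ∃ k, l ≤ Z k ω ∧ ∀ j ≠ k, Z j ω ≤ l := by
  rw [← integral_add_sum_max hZ, integral_eq_iff_of_ae_le (integrable_ciSup hZ)
    (integrable_add_sum_max hZ l) (.of_forall fun ω => ciSup_le_add_sum_max (fun i => Z i ω) l)]
  exact Filter.eventually_congr (.of_forall fun ω => ciSup_eq_add_sum_max_iff (fun i => Z i ω) l)

end ExpectedMax

/-! ### A coupling under which exactly one of given events occurs -/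

section PartitionCoupling

variable {ι : Type*} [DecidableEq ι] {X : ι → Type*} [∀ i, MeasurableSpace (X i)]
  {μ : ∀ i, Measure (X i)} {A : ∀ i, Set (X i)}

/-- The laws `μ j` conditioned on the event `A i` in coordinate `i` and on the complement of `A j`
in every other coordinate `j`. -/
noncomputable def condOnly (μ : ∀ i, Measure (X i)) (A : ∀ i, Set (X i)) (i j : ι) :
    Measure (X j) :=
  (μ j)[|if j = i then A j else (A j)ᶜ]

instance (i j : ι) : IsZeroOrProbabilityMeasure (condOnly μ A i j) := by
  unfold condOnly
  infer_instance

variable [Fintype ι]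

/-- The joint law obtained by choosing a coordinate `i` with probability `μ i (A i)` and then
drawing all coordinates independently from the laws `condOnly μ A i`, so that `A i` is the only one
of the events that occurs. It is a coupling of the laws `μ i` as soon as the weights `μ i (A i)` sum
to one. -/
noncomputable def partitionCoupling (μ : ∀ i, Measure (X i)) (A : ∀ i, Set (X i)) :
    Measure (∀ i, X i) :=
  ∑ i, μ i (A i) • Measure.pi (condOnly μ A i)

lemma ae_existsUnique_mem_partitionCoupling (hA : ∀ i, MeasurableSet (A i)) :
    ∀ᵐ x ∂partitionCoupling μ A, ∃! i, x i ∈ A i := by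
  rw [partitionCoupling, ae_finsetSum_measure_iff]
  refine fun i _ => Measure.ae_smul_measure ?_ _
  have hcoord : ∀ j, ∀ᵐ x ∂Measure.pi (condOnly μ A i), x j ∈ if j = i then A j else (A j)ᶜ := by
    refine fun j => Measure.tendsto_eval_ae_ae.eventually (ae_cond_mem ?_)
    split_ifs
    exacts [hA j, (hA j).compl]
  filter_upwards [ae_all_iff.2 hcoord] with x hx
  refine ⟨i, by simpa using hx i, fun j hj => ?_⟩
  by_contra hji
  have hxj := hx j
  rw [if_neg hji] at hxj
  exact hxj hj

variable [∀ i, IsProbabilityMeasure (μ i)]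

lemma sum_erase_eq_measure_compl (hA : ∀ i, MeasurableSet (A i)) (hsum : ∑ i, μ i (A i) = 1)
    (j : ι) : ∑ i ∈ Finset.univ.erase j, μ i (A i) = μ j (A j)ᶜ := by
  refine (ENNReal.add_right_inj (measure_ne_top (μ j) (A j))).1 ?_
  rw [Finset.add_sum_erase _ (fun i => μ i (A i)) (Finset.mem_univ j), hsum,
    measure_add_measure_compl (hA j), measure_univ]

lemma isProbabilityMeasure_condOnly (hA : ∀ i, MeasurableSet (A i)) (hsum : ∑ i, μ i (A i) = 1)
    {i : ι} (hi : μ i (A i) ≠ 0) (j : ι) : IsProbabilityMeasure (condOnly μ A i j) := by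
  refine cond_isProbabilityMeasure ?_
  split_ifs with hji
  · exact hji ▸ hi
  · rw [← sum_erase_eq_measure_compl hA hsum]
    exact fun h => hi (Finset.sum_eq_zero_iff.1 h i (by simp [Ne.symm hji]))

lemma measure_smul_cond {Ω : Type*} [MeasurableSpace Ω] (ν : Measure Ω) [IsFiniteMeasure ν]
    (s : Set Ω) : ν s • ν[|s] = ν.restrict s := by
  by_cases h : ν s = 0
  · simp [h, Measure.restrict_eq_zero.2 h]
  · rw [ProbabilityTheory.cond, smul_smul, ENNReal.mul_inv_cancel h (measure_ne_top ν s), one_smul]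

lemma map_eval_partitionCoupling (hA : ∀ i, MeasurableSet (A i)) (hsum : ∑ i, μ i (A i) = 1)
    (j : ι) : (partitionCoupling μ A).map (Function.eval j) = μ j := by
  have hterm : ∀ i, (μ i (A i) • Measure.pi (condOnly μ A i)).map (Function.eval j) =
      μ i (A i) • condOnly μ A i j := by
    intro i
    by_cases hi : μ i (A i) = 0
    · simp [hi]
    · have := isProbabilityMeasure_condOnly hA hsum hi
      rw [Measure.map_smul, (measurePreserving_eval (condOnly μ A i) j).map_eq]
  have hne : ∀ i ∈ Finset.univ.erase j, condOnly μ A i j = (μ j)[|(A j)ᶜ] := fun i hi => by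
    rw [condOnly, if_neg (Finset.ne_of_mem_erase hi).symm]
  calc (partitionCoupling μ A).map (Function.eval j)
      = ∑ i, μ i (A i) • condOnly μ A i j := by
        rw [partitionCoupling, Measure.map_finset_sum (measurable_pi_apply j).aemeasurable]
        exact Finset.sum_congr rfl fun i _ => hterm i
    _ = μ j (A j) • (μ j)[|A j] + μ j (A j)ᶜ • (μ j)[|(A j)ᶜ] := by
        rw [← Finset.add_sum_erase _ _ (Finset.mem_univ j), ← sum_erase_eq_measure_compl hA hsum,
          Finset.sum_smul, Finset.sum_congr rfl fun i hi => by rw [hne i hi]]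
        simp only [condOnly, if_true]
    _ = μ j := by
        rw [measure_smul_cond, measure_smul_cond, Measure.restrict_add_restrict_compl (hA j)]

lemma isProbabilityMeasure_partitionCoupling (hA : ∀ i, MeasurableSet (A i))
    (hsum : ∑ i, μ i (A i) = 1) : IsProbabilityMeasure (partitionCoupling μ A) := by
  obtain ⟨j⟩ : Nonempty ι := by
    by_contra h
    rw [not_nonempty_iff] at h
    simp at hsum
  have : IsProbabilityMeasure ((partitionCoupling μ A).map (Function.eval j)) := by
    rw [map_eval_partitionCoupling hA hsum]
    infer_instance
  exact Measure.isProbabilityMeasure_of_map (Function.eval j)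

end PartitionCoupling

/-! ### Choice probabilities of the marginal distribution model -/

lemma continuous_cdf (μ : Measure ℝ) [IsProbabilityMeasure μ] [NullSingletonClass μ] :
    Continuous (cdf μ) := by
  refine continuous_iff_continuousAt.2 fun x => ?_
  have hjump := StieltjesFunction.measure_singleton (cdf μ) x
  rw [measure_cdf, measure_singleton, eq_comm, ENNReal.ofReal_eq_zero, sub_nonpos] at hjump
  rw [(cdf μ).mono.continuousAt_iff_leftLim_eq_rightLim, StieltjesFunction.rightLim_eq]
  exact ((cdf μ).mono.leftLim_le le_rfl).antisymm hjump

lemma comp_eq_of_le_comp_of_sum_le {α β M : Type*} [Fintype α] [Fintype β] [AddCommMonoid M]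
    [PartialOrder M] [IsOrderedCancelAddMonoid M] {f : α → M} {g : β → M} (e : α ↪ β)
    (hg : 0 ≤ g) (hsum : ∑ b, g b ≤ ∑ a, f a) (hle : f ≤ g ∘ e) : g ∘ e = f := by
  have hcomp : ∑ a, g (e a) ≤ ∑ b, g b := by
    rw [← Finset.sum_map]
    exact Finset.sum_le_univ_sum_of_nonneg hg
  have heq := (Finset.sum_eq_sum_iff_of_le fun a _ => hle a).1
    ((Finset.sum_le_sum fun a _ => hle a).antisymm (hcomp.trans hsum))
  exact funext fun a => (heq a (Finset.mem_univ a)).symm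

namespace MDMData

section Exceedance

variable {n : ℕ} (M : MDMData n)

instance (i : Fin n) : IsProbabilityMeasure (M.law i) := M.isProbabilityMeasure_law i

instance (i : Fin n) : NullSingletonClass (M.law i) :=
  ⟨fun _ => M.absolutelyContinuous_law i (measure_singleton _)⟩

/-- The probability that the utility of product `i` exceeds the level `l`. -/
noncomputable def exceedance (i : Fin n) (l : ℝ) : ℝ :=
  (M.law i).real (Set.Ioi (l - M.ν i))

lemma exceedance_eq_one_sub_cdf (i : Fin n) (l : ℝ) :
    M.exceedance i l = 1 - cdf (M.law i) (l - M.ν i) := by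
  rw [cdf_eq_real, exceedance, ← Set.compl_Iic, probReal_compl_eq_one_sub measurableSet_Iic]

lemma antitone_exceedance (i : Fin n) : Antitone (M.exceedance i) := fun _ _ h =>
  measureReal_mono (Set.Ioi_subset_Ioi (sub_le_sub_right h _))

lemma continuous_exceedance (i : Fin n) : Continuous (M.exceedance i) := by
  simp only [funext (M.exceedance_eq_one_sub_cdf i)]
  exact continuous_const.sub ((continuous_cdf (M.law i)).comp (continuous_sub_right _))

lemma tendsto_exceedance_atBot (i : Fin n) :
    Filter.Tendsto (M.exceedance i) Filter.atBot (nhds 1) := by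
  simp only [funext (M.exceedance_eq_one_sub_cdf i), sub_eq_add_neg _ (M.ν i)]
  simpa using (tendsto_const_nhds (x := (1 : ℝ))).sub ((tendsto_cdf_atBot (M.law i)).comp
    (Filter.tendsto_atBot_add_const_right _ (-M.ν i) Filter.tendsto_id))

lemma tendsto_exceedance_atTop (i : Fin n) :
    Filter.Tendsto (M.exceedance i) Filter.atTop (nhds 0) := by
  simp only [funext (M.exceedance_eq_one_sub_cdf i), sub_eq_add_neg _ (M.ν i)]
  simpa using (tendsto_const_nhds (x := (1 : ℝ))).sub ((tendsto_cdf_atTop (M.law i)).comp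
    (Filter.tendsto_atTop_add_const_right _ (-M.ν i) Filter.tendsto_id))

lemma exists_sum_exceedance_eq_one {S : Finset (Fin n)} (hS : 2 ≤ S.card) :
    ∃ l, ∑ i ∈ S, M.exceedance i l = 1 := by
  have hbot := tendsto_finsetSum S fun i _ => M.tendsto_exceedance_atBot i
  have htop := tendsto_finsetSum S fun i _ => M.tendsto_exceedance_atTop i
  have hcard : (1 : ℝ) < ∑ _i ∈ S, 1 := by
    rw [Finset.sum_const, nsmul_one]
    exact_mod_cast hS
  obtain ⟨a, ha⟩ := (hbot.eventually_const_lt hcard).exists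
  obtain ⟨b, hb⟩ := (htop.eventually_lt_const (u := 1) (by simp)).exists
  exact mem_range_of_exists_le_of_exists_ge
    (continuous_finsetSum S fun i _ => M.continuous_exceedance i) ⟨b, hb.le⟩ ⟨a, ha.le⟩

end Exceedance

section Dual

variable {n : ℕ} {M : MDMData n} {S : Finset (Fin n)} {θ : Measure (Fin n → ℝ)}

lemma measurePreserving_eval_of_mem_jointLaws (hθ : θ ∈ M.jointLaws) (i : Fin n) :
    MeasurePreserving (fun ε : Fin n → ℝ => ε i) θ (M.law i) :=
  ⟨measurable_pi_apply i, hθ.2 i⟩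

lemma integrable_utility (hθ : θ ∈ M.jointLaws) (i : Fin n) :
    Integrable (fun ε : Fin n → ℝ => M.ν i + ε i) θ :=
  have := hθ.1
  (integrable_const _).add
    ((measurePreserving_eval_of_mem_jointLaws hθ i).integrable_comp_of_integrable
      (M.integrable_law i))

lemma ae_utility_ne (hθ : θ ∈ M.jointLaws) (l : ℝ) : ∀ᵐ ε ∂θ, ∀ i, M.ν i + ε i ≠ l := by
  refine ae_all_iff.2 fun i => ?_
  have hlaw : ∀ᵐ t ∂M.law i, t ≠ l - M.ν i := by simp [ae_iff]
  filter_upwards [(measurePreserving_eval_of_mem_jointLaws hθ i).quasiMeasurePreserving.ae hlaw]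
    with ε hε
  exact fun h => hε (eq_sub_of_add_eq' h)

/-- The bound `l + ∑_{i ∈ S} E (ν_i + ε_i - l)⁺` on the expected maximal utility. It depends on the
marginals alone, and its minimum over `l` is the dual of the maximization over joint laws. -/
noncomputable def dualBound (M : MDMData n) (S : Finset (Fin n)) (l : ℝ) : ℝ :=
  l + ∑ i : {i // i ∈ S}, ∫ t, max (M.ν i.1 + t - l) 0 ∂(M.law i.1)

lemma dualBound_eq_of_mem_jointLaws (hθ : θ ∈ M.jointLaws) (S : Finset (Fin n)) (l : ℝ) :
    M.dualBound S l = l + ∑ i : {i // i ∈ S}, ∫ ε, max (M.ν i.1 + ε i.1 - l) 0 ∂θ := by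
  refine congrArg (l + ·) (Finset.sum_congr rfl fun i _ => ?_)
  have hcont : Continuous fun t => max (M.ν i.1 + t - l) 0 := by fun_prop
  rw [← hθ.2 i.1, integral_map (measurable_pi_apply _).aemeasurable hcont.aestronglyMeasurable]

lemma expectedMax_le_dualBound (hθ : θ ∈ M.jointLaws) (hS : S.Nonempty) (l : ℝ) :
    M.expectedMax S θ ≤ M.dualBound S l := by
  have := hθ.1
  have := hS.to_subtype
  rw [dualBound_eq_of_mem_jointLaws hθ]
  exact integral_ciSup_le_add_sum_integral_max (fun i : {i // i ∈ S} => integrable_utility hθ i.1) l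

lemma expectedMax_eq_dualBound_iff (hθ : θ ∈ M.jointLaws) (hS : S.Nonempty) (l : ℝ) :
    M.expectedMax S θ = M.dualBound S l ↔
      ∀ᵐ ε ∂θ, ∃ k : {i // i ∈ S}, l ≤ M.ν k.1 + ε k.1 ∧ ∀ j ≠ k, M.ν j.1 + ε j.1 ≤ l := by
  have := hθ.1
  have := hS.to_subtype
  rw [dualBound_eq_of_mem_jointLaws hθ]
  exact integral_ciSup_eq_add_sum_integral_max_iff
    (fun i : {i // i ∈ S} => integrable_utility hθ i.1) l

lemma choiceProb_eq_exceedance_of_expectedMax_eq (hθ : θ ∈ M.jointLaws) {l : ℝ}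
    (h : M.expectedMax S θ = M.dualBound S l) {i : Fin n} (hi : i ∈ S) :
    M.choiceProb S θ i = M.exceedance i l := by
  have hset : {ε : Fin n → ℝ | ∀ j ∈ S, j ≠ i → M.ν j + ε j < M.ν i + ε i} =ᵐ[θ]
      (fun ε : Fin n → ℝ => ε i) ⁻¹' Set.Ioi (l - M.ν i) := by
    filter_upwards [(expectedMax_eq_dualBound_iff hθ ⟨i, hi⟩ l).1 h, ae_utility_ne hθ l]
      with ε ⟨k, hk, hrest⟩ hne
    have hargmax := forall_ne_lt_iff_lt_of_forall_ne_lt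
      (z := fun j : {j // j ∈ S} => M.ν j.1 + ε j.1) (hk.lt_of_ne' (hne k.1))
      (fun j hj => (hrest j hj).lt_of_ne (hne j.1)) ⟨i, hi⟩
    refine propext ?_
    change (∀ j ∈ S, j ≠ i → M.ν j + ε j < M.ν i + ε i) ↔ l - M.ν i < ε i
    rw [sub_lt_iff_lt_add', ← hargmax]
    simp only [Subtype.forall, ne_eq, Subtype.mk.injEq]
  rw [choiceProb, exceedance, measureReal_congr hset]
  exact (measurePreserving_eval_of_mem_jointLaws hθ i).measureReal_preimage
    measurableSet_Ioi.nullMeasurableSet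

lemma exists_expectedMax_eq_dualBound {l : ℝ} (hl : ∑ i ∈ S, M.exceedance i l = 1) :
    ∃ θ ∈ M.jointLaws, M.expectedMax S θ = M.dualBound S l := by
  let A : Fin n → Set ℝ := fun i => if i ∈ S then Set.Ioi (l - M.ν i) else ∅
  have hA : ∀ i, MeasurableSet (A i) := fun i => by
    dsimp only [A]
    split_ifs
    exacts [measurableSet_Ioi, .empty]
  have hsum : ∑ i, M.law i (A i) = 1 := by
    have hsumS : ∑ i ∈ S, M.law i (Set.Ioi (l - M.ν i)) = 1 := by
      rw [← ENNReal.toReal_eq_one_iff, ENNReal.toReal_sum fun i _ => measure_ne_top _ _]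
      exact hl
    simpa only [A, apply_ite, measure_empty, Finset.sum_ite_mem, Finset.univ_inter] using hsumS
  have hθ : partitionCoupling M.law A ∈ M.jointLaws :=
    ⟨isProbabilityMeasure_partitionCoupling hA hsum, map_eval_partitionCoupling hA hsum⟩
  have hS : S.Nonempty := Finset.nonempty_of_sum_ne_zero (hl.trans_ne one_ne_zero)
  refine ⟨_, hθ, (expectedMax_eq_dualBound_iff hθ hS l).2 ?_⟩
  filter_upwards [ae_existsUnique_mem_partitionCoupling hA] with ε ⟨k, hkA, huniq⟩
  have hkS : k ∈ S := by
    by_contra hk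
    simp [A, hk] at hkA
  refine ⟨⟨k, hkS⟩, ?_, fun j hj => ?_⟩
  · have hk : l - M.ν k < ε k := by simpa only [A, if_pos hkS, Set.mem_Ioi] using hkA
    exact (sub_lt_iff_lt_add'.1 hk).le
  · by_contra! hlt
    refine hj (Subtype.ext (huniq j.1 ?_))
    simpa only [A, if_pos j.2, Set.mem_Ioi] using sub_lt_iff_lt_add'.2 hlt

lemma IsExtremal.choiceProb_eq_exceedance (hθ : M.IsExtremal S θ) {l : ℝ}
    (hl : ∑ i ∈ S, M.exceedance i l = 1) {i : Fin n} (hi : i ∈ S) :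
    M.choiceProb S θ i = M.exceedance i l := by
  obtain ⟨θ₀, hθ₀, h₀⟩ := exists_expectedMax_eq_dualBound hl
  exact choiceProb_eq_exceedance_of_expectedMax_eq hθ.1
    ((expectedMax_le_dualBound hθ.1 ⟨i, hi⟩ l).antisymm (h₀ ▸ hθ.2 θ₀ hθ₀)) hi

lemma exists_isExtremal {l : ℝ} (hl : ∑ i ∈ S, M.exceedance i l = 1) :
    ∃ θ, M.IsExtremal S θ := by
  have hS : S.Nonempty := Finset.nonempty_of_sum_ne_zero (hl.trans_ne one_ne_zero)
  obtain ⟨θ₀, hθ₀, h₀⟩ := exists_expectedMax_eq_dualBound hl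
  exact ⟨θ₀, hθ₀, fun θ' hθ' => h₀ ▸ expectedMax_le_dualBound hθ' hS l⟩

lemma choiceProb_singleton [IsProbabilityMeasure θ] (i : Fin n) : M.choiceProb {i} θ i = 1 := by
  have huniv : {ε : Fin n → ℝ | ∀ j ∈ ({i} : Finset (Fin n)), j ≠ i →
      M.ν j + ε j < M.ν i + ε i} = Set.univ :=
    Set.eq_univ_of_forall fun ε j hj hji => absurd (Finset.mem_singleton.1 hj) hji
  rw [choiceProb, huniv, probReal_univ]

lemma IsExtremal.sum_choiceProb (hθ : M.IsExtremal S θ) (hS : S.Nonempty) :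
    ∑ i ∈ S, M.choiceProb S θ i = 1 := by
  have := hθ.1.1
  rcases (Nat.succ_le_iff.2 hS.card_pos).eq_or_lt with hcard | hcard
  · obtain ⟨i, rfl⟩ := Finset.card_eq_one.1 hcard.symm
    rw [Finset.sum_singleton, choiceProb_singleton]
  · obtain ⟨l, hl⟩ := M.exists_sum_exceedance_eq_one hcard
    rw [← hl]
    exact Finset.sum_congr rfl fun i hi => hθ.choiceProb_eq_exceedance hl hi

lemma IsExtremal.choiceProb_anti {T : Finset (Fin n)} {θS θT : Measure (Fin n → ℝ)}
    (hθS : M.IsExtremal S θS) (hθT : M.IsExtremal T θT) (hST : S ⊆ T) {i : Fin n} (hi : i ∈ S) :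
    M.choiceProb T θT i ≤ M.choiceProb S θS i := by
  have := hθS.1.1
  have := hθT.1.1
  rcases (Nat.succ_le_iff.2 (Finset.card_pos.2 ⟨i, hi⟩)).eq_or_lt with hcard | hcard
  · obtain ⟨j, rfl⟩ := Finset.card_eq_one.1 hcard.symm
    obtain rfl := Finset.mem_singleton.1 hi
    exact measureReal_le_one.trans_eq (choiceProb_singleton i).symm
  obtain ⟨lS, hlS⟩ := M.exists_sum_exceedance_eq_one hcard
  obtain ⟨lT, hlT⟩ := M.exists_sum_exceedance_eq_one (hcard.trans_le (Finset.card_le_card hST))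
  rw [hθS.choiceProb_eq_exceedance hlS hi, hθT.choiceProb_eq_exceedance hlT (hST hi)]
  rcases le_total lS lT with h | h
  · exact M.antitone_exceedance i h
  · rw [← Finset.sum_coe_sort] at hlS hlT
    exact (congrFun (comp_eq_of_le_comp_of_sum_le (Subtype.impEmbedding _ _ hST)
      (fun j : {j // j ∈ T} => measureReal_nonneg) (hlT.trans hlS.symm).le
      fun j : {j // j ∈ S} => M.antitone_exceedance j.1 h) ⟨i, hi⟩).le

end Dual

end MDMData

/-! ### Marginals with piecewise constant densities -/

section StepLaw

/-- `g` is strictly decreasing on `{a, …, b}`, from `1` at `a` to `0` at `b`: the survival function,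
at integers, of a law whose support is `[a, b]`. -/
structure IsStrictSurvival (a b : ℕ) (g : ℕ → ℝ) : Prop where
  le : a ≤ b
  strictAntiOn : StrictAntiOn g (Set.Icc a b)
  left_eq_one : g a = 1
  right_eq_zero : g b = 0

/-- The measure with density `g k - g (k + 1)` on `(k, k + 1]` for every integer `a ≤ k < b`. -/
noncomputable def stepLaw (a b : ℕ) (g : ℕ → ℝ) : Measure ℝ :=
  ∑ k ∈ Finset.Ico a b, ENNReal.ofReal (g k - g (k + 1)) • volume.restrict (Set.Ioc (k : ℝ) (k + 1))

variable {a b : ℕ} {g : ℕ → ℝ}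

lemma IsStrictSurvival.nonneg (hg : IsStrictSurvival a b g) {m : ℕ} (hm : m ∈ Set.Icc a b) :
    0 ≤ g m :=
  hg.right_eq_zero ▸ hg.strictAntiOn.antitoneOn hm (Set.right_mem_Icc.2 hg.le) hm.2

lemma IsStrictSurvival.sub_succ_pos (hg : IsStrictSurvival a b g) {k : ℕ} (hak : a ≤ k)
    (hkb : k < b) : 0 < g k - g (k + 1) :=
  sub_pos.2 <| hg.strictAntiOn ⟨hak, hkb.le⟩ ⟨hak.trans k.le_succ, hkb⟩ k.lt_succ_self

lemma stepLaw_apply {s : Set ℝ} (hs : MeasurableSet s) : stepLaw a b g s =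
    ∑ k ∈ Finset.Ico a b,
      ENNReal.ofReal (g k - g (k + 1)) * volume (s ∩ Set.Ioc (k : ℝ) (k + 1)) := by
  simp only [stepLaw, Measure.finsetSum_apply, Measure.smul_apply, Measure.restrict_apply hs,
    smul_eq_mul]

lemma volume_Ioi_inter_Ioc_succ (m k : ℕ) :
    volume (Set.Ioi (m : ℝ) ∩ Set.Ioc (k : ℝ) (k + 1)) = if m ≤ k then 1 else 0 := by
  rw [Set.inter_comm, Set.Ioc_inter_Ioi, Real.volume_Ioc]
  split_ifs with h
  · rw [sup_eq_left.2 (Nat.cast_le.2 h)]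
    simp
  · have hkm : (k : ℝ) + 1 ≤ m := by exact_mod_cast not_le.1 h
    exact ENNReal.ofReal_eq_zero.2 (sub_nonpos.2 (hkm.trans le_sup_right))

lemma stepLaw_Ioi (hg : IsStrictSurvival a b g) {m : ℕ} (hm : m ∈ Set.Icc a b) :
    stepLaw a b g (Set.Ioi (m : ℝ)) = ENNReal.ofReal (g m) := by
  have hfilter : (Finset.Ico a b).filter (m ≤ ·) = Finset.Ico m b := by
    rw [Finset.Ico_filter_le, max_eq_right hm.1]
  have htelescope : ∑ k ∈ Finset.Ico m b, (g k - g (k + 1)) = g m := by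
    have h := Finset.sum_Ico_sub (fun k => -g k) hm.2
    simpa only [neg_sub_neg, hg.right_eq_zero, sub_zero] using h
  simp only [stepLaw_apply measurableSet_Ioi, volume_Ioi_inter_Ioc_succ, mul_ite, mul_one,
    mul_zero]
  rw [← Finset.sum_filter, hfilter, ← ENNReal.ofReal_sum_of_nonneg, htelescope]
  intro k hk
  rw [Finset.mem_Ico] at hk
  exact (hg.sub_succ_pos (hm.1.trans hk.1) hk.2).le

lemma stepLaw_compl_Ioc : stepLaw a b g (Set.Ioc (a : ℝ) b)ᶜ = 0 := by
  rw [stepLaw_apply measurableSet_Ioc.compl]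
  refine Finset.sum_eq_zero fun k hk => ?_
  rw [Finset.mem_Ico] at hk
  have hsub : Set.Ioc (k : ℝ) (k + 1) ⊆ Set.Ioc (a : ℝ) b :=
    Set.Ioc_subset_Ioc (by exact_mod_cast hk.1) (by exact_mod_cast hk.2)
  rw [hsub.disjoint_compl_left.inter_eq, measure_empty, mul_zero]

lemma isProbabilityMeasure_stepLaw (hg : IsStrictSurvival a b g) :
    IsProbabilityMeasure (stepLaw a b g) := by
  have hae : Set.Ioi (a : ℝ) ∈ ae (stepLaw a b g) :=
    measure_mono_null (Set.compl_subset_compl.2 fun _ ht => ht.1) stepLaw_compl_Ioc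
  refine ⟨?_⟩
  rw [← measure_congr (Filter.eventuallyEq_univ.2 hae), stepLaw_Ioi hg (Set.left_mem_Icc.2 hg.le),
    hg.left_eq_one, ENNReal.ofReal_one]

lemma absolutelyContinuous_stepLaw : stepLaw a b g ≪ volume := by
  intro s hs
  rw [stepLaw, Measure.finsetSum_apply]
  refine Finset.sum_eq_zero fun k _ => ?_
  rw [Measure.smul_apply, Measure.restrict_le_self.absolutelyContinuous hs, smul_zero]

lemma integrable_id_stepLaw : Integrable (fun t : ℝ => t) (stepLaw a b g) :=
  integrable_finsetSum_measure.2 fun _ _ =>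
    (continuous_id.integrableOn_Icc.mono_set Set.Ioc_subset_Icc_self).integrable.smul_measure
      ENNReal.ofReal_ne_top

lemma stepLaw_Ioc_pos (hg : IsStrictSurvival a b g) {s t : ℝ} (has : a ≤ s) (hst : s < t)
    (htb : t ≤ b) : 0 < stepLaw a b g (Set.Ioc s t) := by
  have hs : 0 ≤ s := a.cast_nonneg.trans has
  have hak : a ≤ ⌊s⌋₊ := Nat.le_floor has
  have hkb : ⌊s⌋₊ < b := (Nat.floor_lt hs).2 (hst.trans_le htb)
  rw [stepLaw_apply measurableSet_Ioc, Finset.sum_pos_iff]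
  refine ⟨⌊s⌋₊, Finset.mem_Ico.2 ⟨hak, hkb⟩, ENNReal.mul_pos
    (ENNReal.ofReal_pos.2 (hg.sub_succ_pos hak hkb)).ne' ?_⟩
  rw [Set.Ioc_inter_Ioc, Real.volume_Ioc, sup_eq_left.2 (Nat.floor_le hs),
    ENNReal.ofReal_ne_zero_iff]
  exact sub_pos.2 (lt_min hst (Nat.lt_floor_add_one s))

lemma strictMonoOn_cdf_stepLaw (hg : IsStrictSurvival a b g) :
    StrictMonoOn (fun t => cdf (stepLaw a b g) t) (stepLaw a b g).support := by
  have := isProbabilityMeasure_stepLaw hg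
  have hsub : (stepLaw a b g).support ⊆ Set.Icc (a : ℝ) b :=
    Measure.support_subset_of_isClosed isClosed_Icc
      (measure_mono_null (Set.compl_subset_compl.2 Set.Ioc_subset_Icc_self) stepLaw_compl_Ioc)
  intro s hs t ht hst
  have hpos := stepLaw_Ioc_pos hg (hsub hs).1 hst (hsub ht).2
  have hIoc := StieltjesFunction.measure_Ioc (cdf (stepLaw a b g)) s t
  rw [measure_cdf] at hIoc
  rw [hIoc, ENNReal.ofReal_pos] at hpos
  exact sub_pos.1 hpos

/-- The marginal distribution model with zero utilities whose marginals have the survival functions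
`g i` at the integers in `[a, b]`. -/
noncomputable def stepMDM {n : ℕ} {g : Fin n → ℕ → ℝ} (hg : ∀ i, IsStrictSurvival a b (g i)) :
    MDMData n where
  ν := 0
  law i := stepLaw a b (g i)
  isProbabilityMeasure_law i := isProbabilityMeasure_stepLaw (hg i)
  absolutelyContinuous_law _ := absolutelyContinuous_stepLaw
  strictMonoOn_cdf i := strictMonoOn_cdf_stepLaw (hg i)
  integrable_law _ := integrable_id_stepLaw

lemma exceedance_stepMDM {n : ℕ} {g : Fin n → ℕ → ℝ} (hg : ∀ i, IsStrictSurvival a b (g i))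
    (i : Fin n) {m : ℕ} (hm : m ∈ Set.Icc a b) : (stepMDM hg).exceedance i m = g i m := by
  simp only [MDMData.exceedance, stepMDM, Pi.zero_apply, sub_zero, measureReal_def]
  rw [stepLaw_Ioi (hg i) hm, ENNReal.toReal_ofReal ((hg i).nonneg hm)]

/-- The sequence `q` with the values up to `a` replaced by `1` and those from `b` on by `0`. -/
noncomputable def survivalExtension (a b : ℕ) (q : ℕ → ℝ) (k : ℕ) : ℝ :=
  if k ≤ a then 1 else if b ≤ k then 0 else q k

lemma isStrictSurvival_survivalExtension {q : ℕ → ℝ} (hab : a < b)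
    (hq : StrictAntiOn q (Set.Ioo a b)) (hq01 : ∀ k ∈ Set.Ioo a b, q k ∈ Set.Ioo 0 1) :
    IsStrictSurvival a b (survivalExtension a b q) where
  le := hab.le
  left_eq_one := if_pos le_rfl
  right_eq_zero := by rw [survivalExtension, if_neg hab.not_ge, if_pos le_rfl]
  strictAntiOn k hk m hm hkm := by
    have hka : ¬ m ≤ a := (hk.1.trans_lt hkm).not_ge
    have hkb : ¬ b ≤ k := (hkm.trans_le hm.2).not_ge
    simp only [survivalExtension, if_neg hka, if_neg hkb]
    split_ifs with hmb hak hak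
    · exact one_pos
    · exact (hq01 k ⟨not_le.1 hak, not_le.1 hkb⟩).1
    · exact (hq01 m ⟨not_le.1 hka, not_le.1 hmb⟩).2
    · exact hq ⟨not_le.1 hak, not_le.1 hkb⟩ ⟨not_le.1 hka, not_le.1 hmb⟩ hkm

end StepLaw

/-! ### Linear constraints and regular vectors -/

namespace LinConstraint

variable {ι : Type} [Fintype ι]

lemma isLinearMap_sum_mul (a : ι → ℝ) : IsLinearMap ℝ fun x : ι → ℝ => ∑ j, a j * x j where
  map_add x y := by simp only [Pi.add_apply, mul_add, Finset.sum_add_distrib]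
  map_smul c x := by
    simp only [Pi.smul_apply, smul_eq_mul, Finset.mul_sum, mul_left_comm c]

lemma isClosed_holds (c : LinConstraint ι) : IsClosed {x | c.Holds x} := by
  cases c with
  | ge a b => exact isClosed_le continuous_const (by fun_prop)
  | eq a b => exact isClosed_eq (by fun_prop) continuous_const

lemma convex_holds (c : LinConstraint ι) : Convex ℝ {x | c.Holds x} := by
  cases c with
  | ge a b => exact convex_halfSpace_ge (isLinearMap_sum_mul a) b
  | eq a b => exact convex_hyperplane (isLinearMap_sum_mul a) b

end LinConstraint

section Regular

variable {n : ℕ} {𝒮 : Finset (Finset (Fin n))}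

lemma IsNested.isLaminar (h : IsNested 𝒮) : IsLaminar 𝒮 := by
  obtain ⟨m, s, hs, hmem⟩ := h
  intro S hS T hT hST
  obtain ⟨k, rfl⟩ := (hmem S).1 hS
  obtain ⟨l, rfl⟩ := (hmem T).1 hT
  rcases lt_trichotomy k l with h | rfl | h
  · exact Or.inl (hs h)
  · exact absurd rfl hST
  · exact Or.inr (Or.inl (hs h))

lemma IsLaminar.subset_of_card_le (h : IsLaminar 𝒮) {S T : Finset (Fin n)} (hS : S ∈ 𝒮)
    (hT : T ∈ 𝒮) {i : Fin n} (hiS : i ∈ S) (hiT : i ∈ T) (hcard : S.card ≤ T.card) : S ⊆ T := by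
  by_cases hST : S = T
  · exact hST.subset
  rcases h S hS T hT hST with h | h | h
  · exact h.subset
  · exact absurd (Finset.card_lt_card h) hcard.not_gt
  · exact absurd (h ▸ Finset.mem_inter.2 ⟨hiS, hiT⟩) (Finset.notMem_empty i)

lemma IsChoiceData.empty_notMem {p : PairIdx 𝒮 → ℝ} (hp : IsChoiceData p) : ∅ ∉ 𝒮 := fun h => by
  simpa using (hp ⟨∅, h⟩).2

lemma nonempty_of_mem (h𝒮 : ∅ ∉ 𝒮) {S : Finset (Fin n)} (hS : S ∈ 𝒮) : S.Nonempty :=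
  Finset.nonempty_iff_ne_empty.2 fun h => h𝒮 (h ▸ hS)

lemma pairIdx_ext {a b : PairIdx 𝒮} (hS : a.1 = b.1) (hi : a.2.1 = b.2.1) : a = b := by
  obtain ⟨S, i⟩ := a
  obtain ⟨T, j⟩ := b
  obtain rfl : S = T := hS
  exact congrArg _ (Subtype.ext hi)

lemma card_pos_of_pairIdx (a : PairIdx 𝒮) : 0 < a.1.1.card := Finset.card_pos.2 ⟨a.2.1, a.2.2⟩

/-- The vectors with blocks in the simplices and `x_{i,S} ≥ x_{i,T}` for `S ⊂ T`: the choice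
probabilities that satisfy the regularity axiom. -/
def regularVectors (𝒮 : Finset (Finset (Fin n))) : Set (PairIdx 𝒮 → ℝ) :=
  {x | (∀ a b : PairIdx 𝒮, a.2.1 = b.2.1 → a.1.1 ⊂ b.1.1 → x b ≤ x a) ∧
    (∀ S : {S : Finset (Fin n) // S ∈ 𝒮}, ∑ i : {i : Fin n // i ∈ S.1}, x ⟨S, i⟩ = 1) ∧
    (∀ a : PairIdx 𝒮, 0 ≤ x a)}

section MemRegularVectors

variable {x : PairIdx 𝒮 → ℝ}

lemma block_mem_stdSimplex (hx : x ∈ regularVectors 𝒮) (S : {S : Finset (Fin n) // S ∈ 𝒮}) :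
    block x S ∈ stdSimplex ℝ {i : Fin n // i ∈ S.1} :=
  ⟨fun i => hx.2.2 ⟨S, i⟩, hx.2.1 S⟩

lemma mem_Icc_of_mem_regularVectors (hx : x ∈ regularVectors 𝒮) (a : PairIdx 𝒮) :
    x a ∈ Set.Icc 0 1 :=
  mem_Icc_of_mem_stdSimplex (block_mem_stdSimplex hx a.1) a.2

lemma eq_one_of_card_eq_one (hx : x ∈ regularVectors 𝒮) {a : PairIdx 𝒮} (ha : a.1.1.card = 1) :
    x a = 1 := by
  have : Subsingleton {i : Fin n // i ∈ a.1.1} :=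
    Fintype.card_le_one_iff_subsingleton.1 (by simp [ha])
  rw [← hx.2.1 a.1, Fintype.sum_subsingleton _ a.2]

lemma le_of_card_le (hlam : IsLaminar 𝒮) (hx : x ∈ regularVectors 𝒮) {a b : PairIdx 𝒮}
    (hab : a.2.1 = b.2.1) (hcard : a.1.1.card ≤ b.1.1.card) : x b ≤ x a := by
  have hsub : a.1.1 ⊆ b.1.1 :=
    hlam.subset_of_card_le a.1.2 b.1.2 a.2.2 (hab ▸ b.2.2) hcard
  rcases hsub.eq_or_ssubset with h | h
  · rw [pairIdx_ext (Subtype.ext h) hab]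
  · exact hx.1 a b hab h

end MemRegularVectors

/-- The uniform choice probabilities `1 / |S|`. -/
noncomputable def uniformVector (𝒮 : Finset (Finset (Fin n))) : PairIdx 𝒮 → ℝ :=
  fun a => (a.1.1.card : ℝ)⁻¹

lemma uniformVector_mem_regularVectors (h𝒮 : ∅ ∉ 𝒮) : uniformVector 𝒮 ∈ regularVectors 𝒮 := by
  refine ⟨fun a b _ hab => ?_, fun S => ?_, fun a => inv_nonneg.2 (Nat.cast_nonneg _)⟩
  · exact inv_anti₀ (Nat.cast_pos.2 (card_pos_of_pairIdx a))
      (Nat.cast_le.2 (Finset.card_le_card hab.subset))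
  · have hcard := (nonempty_of_mem h𝒮 S.2).card_ne_zero
    simp [uniformVector, hcard]

lemma regularVectors_eq_iInter :
    regularVectors 𝒮 = ⋂ c, {x | (regularityConstraint 𝒮 c).Holds x} := by
  ext x
  have hge : ∀ t : RegularityIdx 𝒮, (regularityConstraint 𝒮 (.inl t)).Holds x ↔
      x t.1.2 ≤ x t.1.1 := fun t => by
    simp [regularityConstraint, LinConstraint.Holds, sub_mul, Finset.sum_sub_distrib,
      Pi.single_apply]
  have heq : ∀ S, (regularityConstraint 𝒮 (.inr (.inl S))).Holds x ↔
      ∑ i : {i : Fin n // i ∈ S.1}, x ⟨S, i⟩ = 1 := fun S => by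
    simp only [regularityConstraint, LinConstraint.Holds, Fintype.sum_sigma, ite_mul, one_mul,
      zero_mul]
    rw [Fintype.sum_eq_single S fun T hT => by simp [hT]]
    simp
  have hnonneg : ∀ a, (regularityConstraint 𝒮 (.inr (.inr a))).Holds x ↔ 0 ≤ x a := fun a => by
    simp [regularityConstraint, LinConstraint.Holds, Pi.single_apply]
  simp only [Set.mem_iInter, Set.mem_ofPred_eq, Sum.forall, hge, heq, hnonneg]
  exact and_congr_left' ⟨fun h t => h _ _ t.2.1 t.2.2, fun h a b hab hlt => h ⟨(a, b), hab, hlt⟩⟩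

lemma convex_regularVectors : Convex ℝ (regularVectors 𝒮) := by
  rw [regularVectors_eq_iInter]
  exact convex_iInter fun c => (regularityConstraint 𝒮 c).convex_holds

lemma isClosed_regularVectors : IsClosed (regularVectors 𝒮) := by
  rw [regularVectors_eq_iInter]
  exact isClosed_iInter fun c => (regularityConstraint 𝒮 c).isClosed_holds

lemma isCompact_regularVectors : IsCompact (regularVectors 𝒮) :=
  (isCompact_Icc (a := (0 : PairIdx 𝒮 → ℝ)) (b := 1)).of_isClosed_subset isClosed_regularVectors
    fun _ hx => ⟨fun a => (mem_Icc_of_mem_regularVectors hx a).1,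
      fun a => (mem_Icc_of_mem_regularVectors hx a).2⟩

lemma mdmRepresentable_subset_regularVectors (h𝒮 : ∅ ∉ 𝒮) :
    mdmRepresentable 𝒮 ⊆ regularVectors 𝒮 := by
  rintro x ⟨M, hM⟩
  choose θ hθ hblock using hM
  have hx : ∀ a : PairIdx 𝒮, x a = M.choiceProb a.1.1 (θ a.1) a.2.1 := fun a => hblock a.1 a.2
  refine ⟨fun a b hab hST => ?_, fun S => ?_, fun a => hx a ▸ measureReal_nonneg⟩
  · rw [hx, hx, ← hab]
    exact (hθ a.1).choiceProb_anti (hθ b.1) hST.subset a.2.2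
  · rw [← (hθ S).sum_choiceProb (nonempty_of_mem h𝒮 S.2), ← Finset.sum_coe_sort S.1]
    exact Finset.sum_congr rfl fun i _ => hx ⟨S, i⟩

/-! ### Regular vectors over laminar collections are limits of representable vectors -/

/-- The largest `x_{i,S}` over the assortments `S ∋ i` with at least `k` products, or `0` if there
are none. -/
noncomputable def upperEnvelope (x : PairIdx 𝒮 → ℝ) (i : Fin n) (k : ℕ) : ℝ :=
  ⨆ a : {a : PairIdx 𝒮 // a.2.1 = i ∧ k ≤ a.1.1.card}, x a.1

/-- A survival function for product `i` which, on a laminar collection, takes the value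
`s x_{i,S} + t / |S|` at `|S|`. -/
noncomputable def mixedSurvival (x : PairIdx 𝒮 → ℝ) (s t : ℝ) (i : Fin n) : ℕ → ℝ :=
  survivalExtension 1 (n + 1) fun k => s * upperEnvelope x i k + t * (k : ℝ)⁻¹

variable {x : PairIdx 𝒮 → ℝ} {s t : ℝ}

lemma upperEnvelope_mem_Icc (hx : x ∈ regularVectors 𝒮) (i : Fin n) (k : ℕ) :
    upperEnvelope x i k ∈ Set.Icc 0 1 :=
  ⟨Real.iSup_nonneg fun a => (mem_Icc_of_mem_regularVectors hx a.1).1,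
    Real.iSup_le (fun a => (mem_Icc_of_mem_regularVectors hx a.1).2) zero_le_one⟩

lemma antitone_upperEnvelope (hx : x ∈ regularVectors 𝒮) (i : Fin n) :
    Antitone (upperEnvelope x i) := fun _ _ hk =>
  Real.iSup_le (fun a => le_ciSup_of_le (Set.finite_range _).bddAbove
    ⟨a.1, a.2.1, hk.trans a.2.2⟩ le_rfl) (upperEnvelope_mem_Icc hx i _).1

lemma upperEnvelope_card (hlam : IsLaminar 𝒮) (hx : x ∈ regularVectors 𝒮) (a : PairIdx 𝒮) :
    upperEnvelope x a.2.1 a.1.1.card = x a :=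
  le_antisymm (Real.iSup_le (fun b => le_of_card_le hlam hx b.2.1.symm b.2.2) (hx.2.2 a))
    (le_ciSup_of_le (Set.finite_range _).bddAbove ⟨a, rfl, le_rfl⟩ le_rfl)

lemma isStrictSurvival_mixedSurvival (hx : x ∈ regularVectors 𝒮) (hs : 0 ≤ s) (ht : 0 < t)
    (hst : s + t = 1) (i : Fin n) : IsStrictSurvival 1 (n + 1) (mixedSurvival x s t i) := by
  have hE := upperEnvelope_mem_Icc hx i
  refine isStrictSurvival_survivalExtension (Nat.lt_add_of_pos_left i.pos)
    (fun k hk m _ hkm => ?_) fun k hk => ⟨?_, ?_⟩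
  · have hk0 : (0 : ℝ) < k := Nat.cast_pos.2 (zero_lt_one.trans hk.1)
    exact add_lt_add_of_le_of_lt
      (mul_le_mul_of_nonneg_left (antitone_upperEnvelope hx i hkm.le) hs)
      (mul_lt_mul_of_pos_left (inv_strictAnti₀ hk0 (Nat.cast_lt.2 hkm)) ht)
  · have hk0 : (0 : ℝ) < k := Nat.cast_pos.2 (zero_lt_one.trans hk.1)
    exact add_pos_of_nonneg_of_pos (mul_nonneg hs (hE k).1) (mul_pos ht (inv_pos.2 hk0))
  · rw [← hst]
    exact add_lt_add_of_le_of_lt (mul_le_of_le_one_right hs (hE k).2)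
      (mul_lt_of_lt_one_right ht (inv_lt_one_of_one_lt₀ (Nat.one_lt_cast.2 hk.1)))

lemma mixedSurvival_card (hlam : IsLaminar 𝒮) (hx : x ∈ regularVectors 𝒮) (hst : s + t = 1)
    (a : PairIdx 𝒮) :
    mixedSurvival x s t a.2.1 a.1.1.card = (s • x + t • uniformVector 𝒮) a := by
  have hn : ¬ n + 1 ≤ a.1.1.card := Nat.not_le.2 (Nat.lt_succ_of_le (card_finset_fin_le a.1.1))
  simp only [mixedSurvival, survivalExtension, if_neg hn, upperEnvelope_card hlam hx,
    Pi.add_apply, Pi.smul_apply, smul_eq_mul, uniformVector]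
  split_ifs with hcard
  · have hcard1 : a.1.1.card = 1 := hcard.antisymm (card_pos_of_pairIdx a)
    rw [eq_one_of_card_eq_one hx hcard1, hcard1, Nat.cast_one, inv_one, mul_one, mul_one, hst]
  · rfl

lemma openSegment_uniformVector_subset_mdmRepresentable (hlam : IsLaminar 𝒮) (h𝒮 : ∅ ∉ 𝒮)
    (hx : x ∈ regularVectors 𝒮) : openSegment ℝ x (uniformVector 𝒮) ⊆ mdmRepresentable 𝒮 := by
  rintro _ ⟨s, t, hs, ht, hst, rfl⟩
  have hy : s • x + t • uniformVector 𝒮 ∈ regularVectors 𝒮 :=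
    convex_regularVectors hx (uniformVector_mem_regularVectors h𝒮) hs.le ht.le hst
  let M := stepMDM (isStrictSurvival_mixedSurvival hx hs.le ht hst)
  refine ⟨M, fun S => ?_⟩
  have hexc : ∀ i : {i : Fin n // i ∈ S.1},
      M.exceedance i.1 S.1.card = (s • x + t • uniformVector 𝒮) ⟨S, i⟩ := fun i =>
    (exceedance_stepMDM _ i.1 ⟨card_pos_of_pairIdx ⟨S, i⟩,
      (card_finset_fin_le S.1).trans n.le_succ⟩).trans (mixedSurvival_card hlam hx hst ⟨S, i⟩)
  have hsum : ∑ i ∈ S.1, M.exceedance i S.1.card = 1 := by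
    rw [← Finset.sum_coe_sort, ← hy.2.1 S]
    exact Finset.sum_congr rfl fun i _ => hexc i
  obtain ⟨θ, hθ⟩ := MDMData.exists_isExtremal hsum
  exact ⟨θ, hθ, fun i => ((hθ.choiceProb_eq_exceedance hsum i.2).trans (hexc i)).symm⟩

lemma closure_mdmRepresentable (hlam : IsLaminar 𝒮) (h𝒮 : ∅ ∉ 𝒮) :
    closure (mdmRepresentable 𝒮) = regularVectors 𝒮 := by
  refine (closure_minimal (mdmRepresentable_subset_regularVectors h𝒮)
    isClosed_regularVectors).antisymm fun x hx => ?_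
  refine closure_mono (openSegment_uniformVector_subset_mdmRepresentable hlam h𝒮 hx) ?_
  rw [closure_openSegment]
  exact left_mem_segment ℝ x _

/-! ### The limit as a minimum -/

lemma isLeast_image_closure_iInf {X α : Type*} [TopologicalSpace X] [CompleteLinearOrder α]
    [TopologicalSpace α] [OrderClosedTopology α] {f : X → α} {A : Set X} (hA : A.Nonempty)
    (hcompact : IsCompact (closure A)) (hf : ContinuousOn f (closure A)) :
    IsLeast (f '' closure A) (⨅ y ∈ A, f y) := by
  have hlower : ⨅ y ∈ A, f y ∈ lowerBounds (f '' closure A) := by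
    rintro _ ⟨y, hy, rfl⟩
    refine closure_minimal ?_ isClosed_Ici
      (((hf y hy).mono subset_closure).mem_closure_image hy)
    rintro _ ⟨z, hz, rfl⟩
    exact iInf₂_le z hz
  obtain ⟨y, hy, hmin⟩ := hcompact.exists_isMinOn hA.closure hf
  refine ⟨⟨y, hy, le_antisymm ?_ (hlower ⟨y, hy, rfl⟩)⟩, hlower⟩
  exact le_iInf₂ fun z hz => hmin (subset_closure hz)

variable {loss : LossFamily n} {p : PairIdx 𝒮 → ℝ}

lemma continuousOn_totalLoss
    (hcont : ∀ S : {S : Finset (Fin n) // S ∈ 𝒮},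
      ContinuousOn (loss S.1 (block p S)) (stdSimplex ℝ {i : Fin n // i ∈ S.1})) :
    ContinuousOn (totalLoss loss p) (regularVectors 𝒮) := by
  refine continuousOn_finsetSum _ fun S _ => ?_
  have hblock : Continuous fun x : PairIdx 𝒮 → ℝ => block x S :=
    continuous_pi fun i => continuous_apply (⟨S, i⟩ : PairIdx 𝒮)
  exact (hcont S).comp hblock.continuousOn fun x hx => block_mem_stdSimplex hx S

lemma convexOn_totalLoss
    (hconv : ∀ S : {S : Finset (Fin n) // S ∈ 𝒮},
      ConvexOn ℝ≥0 (stdSimplex ℝ {i : Fin n // i ∈ S.1}) (loss S.1 (block p S))) :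
    ConvexOn ℝ≥0 (regularVectors 𝒮) (totalLoss loss p) := by
  refine ⟨fun x hx y hy a b _ _ hab => ?_, fun x hx y hy a b ha hb hab => ?_⟩
  · exact convex_regularVectors hx hy a.2 b.2 (by exact_mod_cast hab)
  · simp only [totalLoss, Finset.smul_sum, ← Finset.sum_add_distrib]
    exact Finset.sum_le_sum fun S _ => (hconv S).2 (block_mem_stdSimplex hx S)
      (block_mem_stdSimplex hy S) ha hb hab

lemma isLeast_mdmLimit (hlam : IsLaminar 𝒮) (h𝒮 : ∅ ∉ 𝒮)
    (hcont : ∀ S : {S : Finset (Fin n) // S ∈ 𝒮},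
      ContinuousOn (loss S.1 (block p S)) (stdSimplex ℝ {i : Fin n // i ∈ S.1})) :
    IsLeast (totalLoss loss p '' regularVectors 𝒮) (mdmLimit loss p) := by
  have hclosure := closure_mdmRepresentable hlam h𝒮
  have hne : (mdmRepresentable 𝒮).Nonempty := by
    rw [← closure_nonempty_iff, hclosure]
    exact ⟨_, uniformVector_mem_regularVectors h𝒮⟩
  rw [← hclosure]
  exact isLeast_image_closure_iInf hne (hclosure ▸ isCompact_regularVectors)
    (hclosure ▸ continuousOn_totalLoss hcont)

lemma image_fst_rankingFeasible (hlam : IsLaminar 𝒮) :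
    Prod.fst '' rankingFeasible 𝒮 = regularVectors 𝒮 := by
  apply Set.Subset.antisymm
  · rintro _ ⟨⟨x, l⟩, ⟨hrank, hsum, hnonneg⟩, rfl⟩
    refine ⟨fun a b hab hST => ?_, hsum, hnonneg⟩
    rcases le_total (l a.1) (l b.1) with h | h
    · exact hrank a b hab h
    · have heq := congrFun (comp_eq_of_le_comp_of_sum_le (f := block x a.1) (g := block x b.1)
        (Subtype.impEmbedding _ _ fun _ hi => hST.subset hi) (fun i => hnonneg ⟨b.1, i⟩)
        ((hsum b.1).trans (hsum a.1).symm).le fun i => hrank ⟨b.1, _⟩ ⟨a.1, i⟩ rfl h) a.2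
      have hb : b = ⟨b.1, a.2.1, hST.subset a.2.2⟩ := pairIdx_ext rfl hab.symm
      rw [hb]
      exact heq.le
  · intro x hx
    exact ⟨(x, fun S => S.1.card),
      ⟨fun a b hab hcard => le_of_card_le hlam hx hab (Nat.cast_le.1 hcard), hx.2⟩, rfl⟩

/-! ### The size of the regularity program -/

lemma feasible_regularityProgram : (regularityProgram loss p).feasible = regularVectors 𝒮 := by
  ext x
  rw [regularVectors_eq_iInter, Set.mem_iInter]
  exact (Fintype.equivFin (RegularityConstraintIdx 𝒮)).symm.forall_congr_right
    (q := fun c => (regularityConstraint 𝒮 c).Holds x)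

lemma card_pairIdx_le : Fintype.card (PairIdx 𝒮) ≤ n * 𝒮.card := by
  have hinj : Function.Injective
      fun a : PairIdx 𝒮 => ((a.2.1, a.1) : Fin n × {S : Finset (Fin n) // S ∈ 𝒮}) :=
    fun a b h => pairIdx_ext (Prod.ext_iff.1 h).2 (Prod.ext_iff.1 h).1
  simpa using Fintype.card_le_of_injective _ hinj

lemma card_regularityIdx_add_card_pairIdx_le :
    Fintype.card (RegularityIdx 𝒮) + Fintype.card (PairIdx 𝒮) ≤ n * 𝒮.card ^ 2 := by
  let f : RegularityIdx 𝒮 ⊕ PairIdx 𝒮 →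
      Fin n × {S : Finset (Fin n) // S ∈ 𝒮} × {S : Finset (Fin n) // S ∈ 𝒮} :=
    Sum.elim (fun t => (t.1.1.2.1, t.1.1.1, t.1.2.1)) fun a => (a.2.1, a.1, a.1)
  have hf : Function.Injective f := by
    refine Function.Injective.sumElim (fun t u h => ?_) (fun a b h => ?_) fun t a h => ?_
    · simp only [Prod.mk.injEq] at h
      exact Subtype.ext (Prod.ext (pairIdx_ext h.2.1 h.1)
        (pairIdx_ext h.2.2 (t.2.1.symm.trans (h.1.trans u.2.1))))
    · simp only [Prod.mk.injEq] at h
      exact pairIdx_ext h.2.1 h.1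
    · simp only [Prod.mk.injEq] at h
      exact t.2.2.ne (congrArg Subtype.val (h.2.1.trans h.2.2.symm))
  simpa [sq] using Fintype.card_le_of_injective f hf

lemma card_le_of_empty_notMem (h𝒮 : ∅ ∉ 𝒮) : 𝒮.card ≤ n * 𝒮.card ^ 2 := by
  rcases 𝒮.eq_empty_or_nonempty with rfl | ⟨S, hS⟩
  · simp
  · obtain ⟨i, -⟩ := nonempty_of_mem h𝒮 hS
    exact (Nat.le_self_pow two_ne_zero _).trans (Nat.le_mul_of_pos_left _ i.pos)

lemma numConstraints_regularityProgram_le (h𝒮 : ∅ ∉ 𝒮) :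
    (regularityProgram loss p).numConstraints ≤ 2 * (n * 𝒮.card ^ 2) := by
  have hpairs := card_regularityIdx_add_card_pairIdx_le (𝒮 := 𝒮)
  have hassortments := card_le_of_empty_notMem h𝒮
  simp only [regularityProgram, Fintype.card_sum, Fintype.card_coe] at hpairs ⊢
  omega

lemma coeff_regularityConstraint_mem (c : RegularityConstraintIdx 𝒮) (a : PairIdx 𝒮) :
    (regularityConstraint 𝒮 c).coeff a ∈ ({-1, 0, 1} : Set ℝ) := by
  rcases c with t | S | b <;>
    simp only [regularityConstraint, LinConstraint.coeff, Pi.sub_apply, Pi.single_apply] <;>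
    split_ifs <;> simp

lemma rhs_regularityConstraint_mem (c : RegularityConstraintIdx 𝒮) :
    (regularityConstraint 𝒮 c).rhs ∈ ({-1, 0, 1} : Set ℝ) := by
  rcases c with _ | _ | _ <;> simp [regularityConstraint, LinConstraint.rhs]

end Regular

theorem corollary2 (n : ℕ) (𝒮 : Finset (Finset (Fin n))) (h𝒮 : IsNested 𝒮 ∨ IsLaminar 𝒮)
    (p : PairIdx 𝒮 → ℝ) (hp : IsChoiceData p) (loss : LossFamily n)
    (hconv : ∀ S : {S : Finset (Fin n) // S ∈ 𝒮},
      ConvexOn ℝ≥0 (stdSimplex ℝ {i : Fin n // i ∈ S.1}) (loss S.1 (block p S)))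
    (hcont : ∀ S : {S : Finset (Fin n) // S ∈ 𝒮},
      ContinuousOn (loss S.1 (block p S)) (stdSimplex ℝ {i : Fin n // i ∈ S.1})) :
    -- the limit of MDM is the attained optimal value of the regularity program
    (regularityProgram loss p).HasMin (mdmLimit loss p) ∧
    -- it is also the attained optimal value of the general program over `(x, lam)`
    IsLeast ((fun q => totalLoss loss p q.1) '' rankingFeasible 𝒮) (mdmLimit loss p) ∧
    -- the regularity program is convex
    (regularityProgram loss p).IsConvex ∧
    -- its feasible region is cut out by the regularity and the simplex constraints alone
    (∀ x : PairIdx 𝒮 → ℝ, x ∈ (regularityProgram loss p).feasible ↔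
      (∀ a b : PairIdx 𝒮, a.2.1 = b.2.1 → a.1.1 ⊂ b.1.1 → x b ≤ x a) ∧
      (∀ S : {S : Finset (Fin n) // S ∈ 𝒮}, ∑ i : {i : Fin n // i ∈ S.1}, x ⟨S, i⟩ = 1) ∧
      (∀ a : PairIdx 𝒮, 0 ≤ x a)) ∧
    -- `O(n |𝒮|)` variables
    Fintype.card (PairIdx 𝒮) ≤ n * 𝒮.card ∧
    -- `O(n |𝒮|²)` linear constraints, with coefficients and right-hand sides in `{-1, 0, 1}`
    (regularityProgram loss p).numConstraints ≤ 2 * (n * 𝒮.card ^ 2) ∧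
    (∀ k, (∀ a, ((regularityProgram loss p).constraint k).coeff a ∈ ({-1, 0, 1} : Set ℝ)) ∧
      ((regularityProgram loss p).constraint k).rhs ∈ ({-1, 0, 1} : Set ℝ)) := by
  have hlam : IsLaminar 𝒮 := h𝒮.elim IsNested.isLaminar id
  have hempty : ∅ ∉ 𝒮 := hp.empty_notMem
  have hfeas : (regularityProgram loss p).feasible = regularVectors 𝒮 := feasible_regularityProgram
  have hleast := isLeast_mdmLimit hlam hempty hcont
  refine ⟨?_, ?_, ⟨?_, ?_⟩, fun x => Set.ext_iff.1 hfeas x, card_pairIdx_le,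
    numConstraints_regularityProgram_le hempty,
    fun k => ⟨coeff_regularityConstraint_mem _, rhs_regularityConstraint_mem _⟩⟩
  · rw [LinConstrainedProgram.HasMin, hfeas]
    exact hleast
  · rw [← image_fst_rankingFeasible hlam, Set.image_image] at hleast
    exact hleast
  · rw [hfeas]
    exact convex_regularVectors
  · rw [hfeas]
    exact convexOn_totalLoss hconv
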